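/- **Setting.** A creased paper is a connected oriented polygonal mesh: finitely many panels (simple plane polygons) glued along sides of equal length. A side shared by two panels is an inner crease; there are $J$ of them. A vertex not on the boundary is an inner vertex. If there is a boundary, one boundary component is chosen as the outer boundary, and the others are the holes. Folding angles are $\boldsymbol\rho\in[-\pi,\pi]^J$. Let $R_z,R_x$ denote rotations about the $z$- and $x$-axis. Around an inner vertex with sector angles $\alpha_1,\dots,\alpha_n$ and inner creases with folding angles $\rho_1,\dots,\rho_n$ in cyclic order, put $R_n(\boldsymbol\rho)=\prod_{j=1}^n R_z(\alpha_j)R_x(\rho_j)$. Around a hole put $T_n(\boldsymbol\rho)=\prod_{j=1}^n\begin{pmatrix}R_z(\beta_j)&v_j\\0&1\end{pmatrix}\begin{pmatrix}R_x(\rho_j)&0\\0&1\end{pmatrix}$, where $\beta_j$ and $v_j\in\mathbb R^2\times\{0\}$ are the angle and the displacement, inside a panel, from the $(j-1)$-st to the $j$-th inner crease incident to the hole. The consistency constraints are $R_n(\boldsymbol\rho)=I$ at every inner vertex and $T_n(\boldsymbol\rho)=I$ at every hole. A rigidly folded state is a pair $(\boldsymbol\rho,\lambda)$ such that $\boldsymbol\rho\in[-\pi,\pi]^J$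 satisfies the consistency constraints, the panels are realized in $\mathbb R^3$ by a map $f$ which is a proper rigid motion on each panel and has folding angle $\rho_c$ along each inner crease $c$, and $\lambda$ is an order function: it assigns to any two distinct points in contact, interior to panels, a side on which one is stacked relative to the other, in such a way that the paper does not cross itself (at creases with $\rho_c=\pm\pi$ the stacking is the one given by the sign). States are considered up to Euclidean motions. A rigid folding motion is a family of folded states $(f_t,\lambda_t)$, $t\in[0,1]$, in which $f_t$ is continuous in $t$ for the supremum metric, the folding angles are continuous, and $\lambda_t$ is continuous (locally constant where contact persists). A state is *rigid* if no rigid folding motion leads from it to a different folded state. The creased paper is *globally rigid* if it has only one rigidly folded state, where folded states are described by their folding angles, i.e. if exactly one $\boldsymbol\rho$ occurs as the vector of folding angles of a rigidly folded state. Fix a rigidly folded state $(\boldsymbol\rho,\lambda)$ in $\mathbb R^3$. Conjugate each $R_n$, $T_n$ by the transformation from its local to the global coordinates in this state. Let $\boldsymbol A$ be the map $\mathbb R^J\to\mathbb R^m$ whose components are the elements $(3,2),(1,3),(2,1)$ for each inner vertex and for each hole with concurrent inner creases, and $(3,2),(1,3),(2,1),(1,4),(2,4),(3,4)$ for each other hole.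 These inner vertices and holes, indexed by $i$, are the single creased papers; $\boldsymbol A_i$ is the corresponding part of $\boldsymbol A$. Let $\mathrm J\boldsymbol A$ and $\mathrm H\boldsymbol A$ be the Jacobian and the Hessian of $\boldsymbol A$ at $\boldsymbol\rho$. The state is * *first-order rigid* if $\mathrm J\boldsymbol A\,d\boldsymbol\rho=0$ only for $d\boldsymbol\rho=0$; * *statically rigid* if for every load $\boldsymbol l\in\mathbb R^J$ there is $\boldsymbol\sigma\in\mathbb R^m$ with $(\mathrm J\boldsymbol A)^T\boldsymbol\sigma+\boldsymbol l=0$; * *pre-stress stable* if there are a positive-definite matrix $B$, block diagonal with one block for each single creased paper, and $\boldsymbol\omega\in\mathbb R^m$ with $\boldsymbol\omega^T\mathrm J\boldsymbol A=0$ such that $(\mathrm J\boldsymbol A)^TB\,\mathrm J\boldsymbol A+\boldsymbol\omega^T\mathrm H\boldsymbol A$ is positive definite; * *second-order rigid* if all $\boldsymbol\rho',\boldsymbol\rho''\in[-\pi,\pi]^J$ with $\mathrm J\boldsymbol A\,\boldsymbol\rho'=0$ and $\boldsymbol\rho'^T\mathrm H\boldsymbol A\,\boldsymbol\rho'+\mathrm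 J\boldsymbol A\,\boldsymbol\rho''=0$ have $\boldsymbol\rho'=0$. **Theorem.** For a rigidly folded state $(\boldsymbol\rho,\lambda)$ of a creased paper: (a) It is first-order rigid if and only if it is statically rigid, and in that case it is pre-stress stable. (b) If it is pre-stress stable, it is second-order rigid. (c) If it is second-order rigid, it is rigid. (d) Let $E=\sum_i f_i(\boldsymbol A_i)$ be an energy function, with one $C^2$ function $f_i$ for each single creased paper. If $E$, restricted to $[-\pi,\pi]^J$, attains its minimum at $\boldsymbol\rho$ and only there, then the creased paper is globally rigid. -/

import Mathlib

open scoped Matrix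

noncomputable section

/-- Rotation by `θ` about the `x`-axis, as a homogeneous `4 × 4` matrix. -/
def rotX (θ : ℝ) : Matrix (Fin 4) (Fin 4) ℝ :=
  !![1, 0, 0, 0;
     0, Real.cos θ, -Real.sin θ, 0;
     0, Real.sin θ, Real.cos θ, 0;
     0, 0, 0, 1]

/-- The motion of the `xy`-plane which is the rotation by `β` about the `z`-axis followed by the
translation by `(v.re, v.im, 0)`. -/
def planarMotion (β : ℝ) (v : ℂ) : Matrix (Fin 4) (Fin 4) ℝ :=
  !![Real.cos β, -Real.sin β, 0, v.re;
     Real.sin β, Real.cos β, 0, v.im;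
     0, 0, 1, 0;
     0, 0, 0, 1]

/-- The homogeneous matrix of `x ↦ R x + v`. -/
def homogeneous (R : Matrix (Fin 3) (Fin 3) ℝ) (v : Fin 3 → ℝ) : Matrix (Fin 4) (Fin 4) ℝ :=
  !![R 0 0, R 0 1, R 0 2, v 0;
     R 1 0, R 1 1, R 1 2, v 1;
     R 2 0, R 2 1, R 2 2, v 2;
     0, 0, 0, 1]

/-- An oriented polygonal mesh, described intrinsically. `S` is the set of all sides of all panels.
Every panel is drawn in its own coordinate plane `ℂ` as a simple polygon which is traversed
counterclockwise: `next s` is the side that follows `s` on the boundary of its panel, and `corner s`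
is the starting point of `s`. The map `glue` pairs the two sides that form an inner crease (with
opposite directions) and fixes the sides that lie on the boundary of the paper. -/
structure PolygonalMesh (S : Type*) [Fintype S] where
  next : Equiv.Perm S
  glue : S → S
  glue_involutive : Function.Involutive glue
  corner : S → ℂ
  corner_ne : ∀ s, corner (next s) ≠ corner s
  /-- Each panel boundary is a simple closed polygon: its half-open sides are disjoint. -/
  simple : ∀ s t, next.SameCycle s t → s ≠ t →
    Disjoint ((fun u : ℝ => corner s + u * (corner (next s) - corner s)) '' Set.Ico 0 1)
      ((fun u : ℝ => corner t + u * (corner (next t) - corner t)) '' Set.Ico 0 1)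
  /-- The signed area of each panel is positive. -/
  counterclockwise : ∀ s, 0 < ∑ i ∈ Finset.range (Function.minimalPeriod next s),
    ((starRingEnd ℂ) (corner (next^[i] s)) * corner (next^[i + 1] s)).im
  glue_length : ∀ s, ‖corner (next (glue s)) - corner (glue s)‖ = ‖corner (next s) - corner s‖
  connected : ∀ s t, Relation.EqvGen (fun a b => b = next a ∨ b = glue a) s t

namespace PolygonalMesh

variable {S : Type*} [Fintype S] (M : PolygonalMesh S)

/-- The panels are the cycles of `next`. -/
def Panel : Type _ := Quot fun a b : S => M.next a = b

/-- The panel of a side. -/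
def panel (s : S) : M.Panel := Quot.mk _ s

/-- The sides that lie on inner creases. -/
def InnerSide : Type _ := {s : S // M.glue s ≠ s}

/-- The inner creases: an inner side is identified with the side it is glued to. -/
def Crease : Type _ := Quot fun a b : M.InnerSide => M.glue a.1 = b.1

instance : Finite M.InnerSide := inferInstanceAs (Finite {s : S // M.glue s ≠ s})

instance : Finite M.Crease := inferInstanceAs (Finite (Quot _))

instance : Fintype M.Crease := Fintype.ofFinite _

instance : DecidableEq M.Crease := Classical.decEq _

/-- The vector from the start to the end of a side, in the plane of its panel. -/
def sideVec (s : S) : ℂ := M.corner (M.next s) - M.corner s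

/-- The point at parameter `u` of a side, in the plane of its panel. -/
def sidePoint (s : S) (u : ℝ) : ℂ := M.corner s + u * M.sideVec s

open Classical in
/-- The folding angle at a side (`0` if the side is not on an inner crease). -/
def angleAt (ρ : M.Crease → ℝ) (s : S) : ℝ :=
  if h : M.glue s ≠ s then ρ (Quot.mk _ ⟨s, h⟩) else 0

/-! ### Walking around a vertex or a boundary component -/

/-- The first inner side that is met when the boundary of the panel of `d` is traversed backwards
from the start of `d`. -/
def stepSide (d : S) : S :=
  M.next.symm^[sInf {k : ℕ | 0 < k ∧ M.glue (M.next.symm^[k] d) ≠ M.next.symm^[k] d}] d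

/-- The step from a panel to the next one counterclockwise around a vertex or a boundary component:
`d` is an inner side that starts there, and `turn d` is the following inner side that starts there,
as a side of the next panel. -/
def turn (d : S) : S := M.glue (M.stepSide d)

/-- The classes of inner sides that are met when walking once around an inner vertex or around
a boundary component. -/
def Loop : Type _ := Quot fun a b : M.InnerSide => M.turn a.1 = b.1

instance : Finite M.Loop := inferInstanceAs (Finite (Quot _))

/-- The loop runs along the boundary of the paper, that is, some step passes a boundary side. The
remaining loops are those around the inner vertices. -/
def IsBoundaryLoop (ℓ : M.Loop) : Prop :=
  ∃ d : M.InnerSide, Quot.mk _ d = ℓ ∧ M.glue (M.next.symm d.1) = M.next.symm d.1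

/-- The side at which the walk around `ℓ` starts. Its panel is the panel `P_n` of the loop. -/
def baseSide (ℓ : M.Loop) : S := (Quot.out ℓ).1

/-- The angle `β` (at a vertex: the sector angle `α`, up to multiples of `2π`) in the panel of `d`
from the inner crease of `d` to the next inner crease, both pointing away from the loop. -/
def stepAngle (d : S) : ℝ := Complex.arg (-M.sideVec (M.stepSide d) / M.sideVec d)

/-- The position `l exp(iγ)` of the origin of the next inner crease, measured in the panel of `d` in
the coordinate system with its origin at the start of `d` and its `x`-axis along `d`. This is `0`
when the step takes place at a single vertex. -/
def stepShift (d : S) : ℂ :=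
  (M.corner (M.next (M.stepSide d)) - M.corner d) / (M.sideVec d / ‖M.sideVec d‖)

/-- One factor of the consistency constraint. -/
def stepMatrix (ρ : M.Crease → ℝ) (d : S) : Matrix (Fin 4) (Fin 4) ℝ :=
  planarMotion (M.stepAngle d) (M.stepShift d) * rotX (M.angleAt ρ (M.stepSide d))

/-- The matrix `T_n(ρ)` of a loop. For the loop around an inner vertex all translations vanish and
it is `R_n(ρ)` in homogeneous form. -/
def loopMatrix (ρ : M.Crease → ℝ) (ℓ : M.Loop) : Matrix (Fin 4) (Fin 4) ℝ :=
  ((List.range (Function.minimalPeriod M.turn (M.baseSide ℓ))).map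
    fun i => M.stepMatrix ρ (M.turn^[i] (M.baseSide ℓ))).prod

/-- The lines of the inner creases met by the loop pass through one point: `c d` is the coordinate
of that point on the `x`-axis along `d`. This holds (with `c = 0`) for the loop around an inner
vertex. -/
def Concurrent (ℓ : M.Loop) : Prop :=
  ∃ c : S → ℝ, ∀ d : M.InnerSide, Quot.mk _ d = ℓ →
    M.stepShift d.1 + c (M.turn d.1) * Complex.exp (M.stepAngle d.1 * Complex.I) = c d.1

/-! ### The points of the paper -/

/-- The boundary of a panel. -/
def outline (P : M.Panel) : Set ℂ :=
  ⋃ s ∈ {s | M.panel s = P}, M.sidePoint s '' Set.Icc 0 1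

/-- The closed polygon bounded by the outline. -/
def region (P : M.Panel) : Set ℂ :=
  M.outline P ∪ {z | z ∉ M.outline P ∧ Bornology.IsBounded (connectedComponentIn (M.outline P)ᶜ z)}

/-- The points of the paper, before gluing. -/
def points : Set (M.Panel × ℂ) := {x | x.2 ∈ M.region x.1}

/-- The points of the paper that are not on the crease pattern. -/
def nonCreasePoints : Set (M.Panel × ℂ) := {x | x.2 ∈ M.region x.1 \ M.outline x.1}

/-- Two points represent the same point of the glued paper. -/
def Identified : M.Panel × ℂ → M.Panel × ℂ → Prop :=
  Relation.EqvGen fun x y => ∃ s, M.glue s ≠ s ∧ ∃ u ∈ Set.Icc (0 : ℝ) 1,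
    x = (M.panel s, M.sidePoint s u) ∧ y = (M.panel (M.glue s), M.sidePoint (M.glue s) (1 - u))

/-- The coordinate system on a panel with its origin at the start of `s` and `x`-axis along `s`. -/
def sideFrame (s : S) : Matrix (Fin 4) (Fin 4) ℝ :=
  planarMotion (Complex.arg (M.sideVec s)) (M.corner s)

/-- The coordinate system on a panel with its origin at the end of `s` and `x`-axis against `s`. -/
def sideFrameRev (s : S) : Matrix (Fin 4) (Fin 4) ℝ :=
  planarMotion (Complex.arg (-M.sideVec s)) (M.corner (M.next s))

end PolygonalMesh

/-- A creased paper: a mesh together with the choice of its outer boundary, if it has a boundary.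
The other boundary components are the holes. -/
structure CreasedPaper (S : Type*) [Fintype S] extends PolygonalMesh S where
  outer : Option toPolygonalMesh.Loop
  outer_boundary : ∀ ℓ ∈ outer, toPolygonalMesh.IsBoundaryLoop ℓ
  outer_isSome : (∃ ℓ, toPolygonalMesh.IsBoundaryLoop ℓ) → outer.isSome

namespace CreasedPaper

variable {S : Type*} [Fintype S] (M : CreasedPaper S)

/-- The single creased papers, one for each inner vertex and each hole. -/
def Single : Type _ := {ℓ : M.Loop // ℓ ∉ M.outer}

instance : Finite M.Single := inferInstanceAs (Finite {ℓ : M.Loop // ℓ ∉ M.outer})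

instance : Fintype M.Single := Fintype.ofFinite _

/-- The consistency constraints `R_n(ρ) = I` at inner vertices and `T_n(ρ) = I` at holes. -/
def Consistent (ρ : M.Crease → ℝ) : Prop := ∀ ℓ : M.Single, M.loopMatrix ρ ℓ.1 = 1

/-- An isometric image of the paper in `ℝ³` with given folding angles: each panel is moved by
a proper rigid motion, and along every inner crease the panels are hinged with the folding angle of
that crease. -/
structure Realization where
  ρ : M.Crease → ℝ
  ρ_mem : ∀ c, ρ c ∈ Set.Icc (-Real.pi) Real.pi
  consistent : M.Consistent ρ
  rot : M.Panel → Matrix (Fin 3) (Fin 3) ℝ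
  rot_mem : ∀ P, rot P ∈ Matrix.specialOrthogonalGroup (Fin 3) ℝ
  trans : M.Panel → Fin 3 → ℝ
  hinge : ∀ s, M.glue s ≠ s →
    homogeneous (rot (M.panel (M.glue s))) (trans (M.panel (M.glue s))) * M.sideFrame (M.glue s) =
      homogeneous (rot (M.panel s)) (trans (M.panel s)) * M.sideFrameRev s * rotX (M.angleAt ρ s)

namespace Realization

variable {M} (R : M.Realization)

/-- The map `f` from the paper to `ℝ³`. -/
def f (x : M.Panel × ℂ) : EuclideanSpace ℝ (Fin 3) :=
  WithLp.toLp 2 fun i => R.rot x.1 i 0 * x.2.re + R.rot x.1 i 1 * x.2.im + R.trans x.1 i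

/-- The normal vector of a panel. -/
def normal (P : M.Panel) : EuclideanSpace ℝ (Fin 3) := WithLp.toLp 2 fun i => R.rot P i 2

/-- Two different points off the crease pattern that are in contact. -/
def Contact (p q : M.Panel × ℂ) : Prop :=
  p ∈ M.nonCreasePoints ∧ q ∈ M.nonCreasePoints ∧ p ≠ q ∧ R.f p = R.f q

/-- The paper does not cross itself when it is stacked according to `order`: the map `f` is a
uniform limit of embeddings of the paper in `ℝ³` in which, for points `p`, `q` in contact, the sheet
of `q` lies on the side of `p` to which `order p q` times the normal vector at `p` points. -/
def NonCrossing (order : M.Panel × ℂ → M.Panel × ℂ → SignType) : Prop :=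
  ∃ h : ℕ → M.Panel × ℂ → EuclideanSpace ℝ (Fin 3),
    (∀ n P, ContinuousOn (fun z => h n (P, z)) (M.region P)) ∧
    (∀ n, ∀ x ∈ M.points, ∀ y ∈ M.points, h n x = h n y ↔ M.Identified x y) ∧
    (∀ ε > 0, ∀ᶠ n in Filter.atTop, ∀ x ∈ M.points, dist (h n x) (R.f x) < ε) ∧
    ∀ p q, R.Contact p q → ∃ δ > 0, ∀ᶠ n in Filter.atTop, ∀ w ∈ M.region q.1, dist w q.2 < δ →
      ∀ t : ℝ, h n (q.1, w) = h n p + t • R.normal p.1 → 0 < (order p q : ℝ) * t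

end Realization

/-- A rigidly folded state `(f, λ)`. The order function `λ` is defined on the pairs of non-crease
points in contact; it is extended by `0`. -/
structure FoldedState extends M.Realization where
  order : M.Panel × ℂ → M.Panel × ℂ → SignType
  order_ne_zero_iff : ∀ p q, order p q ≠ 0 ↔ toRealization.Contact p q
  nonCrossing : toRealization.NonCrossing order
  /-- At a crease with folding angle `π` or `-π` the stacking is the one given by the sign. -/
  order_at_crease : ∀ s, M.glue s ≠ s → |M.angleAt ρ s| = Real.pi → ∀ u ∈ Set.Ioo (0 : ℝ) 1,
    ∃ δ > 0, ∀ z w, toRealization.Contact (M.panel s, z) (M.panel (M.glue s), w) →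
      dist z (M.sidePoint s u) < δ → dist w (M.sidePoint (M.glue s) (1 - u)) < δ →
      order (M.panel s, z) (M.panel (M.glue s), w) = SignType.sign (M.angleAt ρ s)

/-- The folding angle space. -/
def foldingAngleSpace : Set (M.Crease → ℝ) := {ρ | ∃ s : M.FoldedState, s.ρ = ρ}

/-- There is only one rigidly folded state, where folded states are described by their folding
angles. -/
def GloballyRigid : Prop := ∃ ρ, M.foldingAngleSpace = {ρ}

/-- The components of the consistency constraints of a single creased paper: three if it is
a single-vertex creased paper (including the holes with concurrent inner creases), and six if it is
a single-hole creased paper. -/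
def Component (ℓ : M.Single) : Type := {k : Fin 6 // k < 3 ∨ ¬ M.Concurrent ℓ.1}

instance (ℓ : M.Single) : Finite (M.Component ℓ) :=
  inferInstanceAs (Finite {k : Fin 6 // k < 3 ∨ ¬ M.Concurrent ℓ.1})

instance (ℓ : M.Single) : Fintype (M.Component ℓ) := Fintype.ofFinite _

/-- The index set of all constraints. -/
def Row : Type _ := (ℓ : M.Single) × M.Component ℓ

instance : Fintype M.Row := inferInstanceAs (Fintype ((ℓ : M.Single) × M.Component ℓ))

/-- The matrix elements (3,2), (1,3), (2,1), (1,4), (2,4), (3,4), with indices counted from `0`. -/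
def element : Fin 6 → Fin 4 × Fin 4 := ![(2, 1), (0, 2), (1, 0), (0, 3), (1, 3), (2, 3)]

namespace FoldedState

variable {M} (s : M.FoldedState)

/-! ### Rigid folding motions -/

/-- Two folded states agree up to a Euclidean motion: same folding angles, same stacking. -/
def Same (s s' : M.FoldedState) : Prop := s.ρ = s'.ρ ∧ s.order = s'.order

/-- A rigid folding motion: the maps `f_t` are continuous in `t` for the supremum metric, the
folding angles are continuous in `t`, and the order function is continuous, that is, locally
constant, on the set of all `(t, p, q)` for which `p`, `q` are in contact at the time `t`. -/
def IsMotion (γ : unitInterval → M.FoldedState) : Prop :=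
  (∀ t, ∀ ε > 0, ∃ δ > 0, ∀ t', dist t' t < δ → ∀ x ∈ M.points, dist ((γ t').f x) ((γ t).f x) < ε) ∧
  Continuous (fun t => (γ t).ρ) ∧
  ∀ t p q, (γ t).Contact p q → ∃ δ > 0, ∀ t' z w, dist t' t < δ → dist z p.2 < δ → dist w q.2 < δ →
    (γ t').Contact (p.1, z) (q.1, w) → (γ t').order (p.1, z) (q.1, w) = (γ t).order p q

/-- There is a rigid folding motion from `s` to a different folded state `s'`. -/
def RigidFoldableTo (s s' : M.FoldedState) : Prop :=
  ¬ Same s s' ∧ ∃ γ : unitInterval → M.FoldedState, IsMotion γ ∧ γ 0 = s ∧ γ 1 = s'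

/-- `s` is not rigid-foldable to any other folded state. -/
def Rigid : Prop := ∀ s' : M.FoldedState, ¬ s.RigidFoldableTo s'

/-! ### The constraint map and its derivatives -/

/-- The transformation from the local coordinate system on the panel `P_n` of a loop to the global
coordinate system of `ℝ³`, in the state `s`. -/
def frame (ℓ : M.Loop) : Matrix (Fin 4) (Fin 4) ℝ :=
  homogeneous (s.rot (M.panel (M.baseSide ℓ))) (s.trans (M.panel (M.baseSide ℓ))) *
    M.sideFrame (M.baseSide ℓ)

/-- The constraint map `A`: the chosen elements of the matrices `T_n(ρ)`, transformed to the global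
coordinate system in which the state `s` is given. -/
def A (ρ : M.Crease → ℝ) (i : M.Row) : ℝ :=
  (s.frame i.1.1 * M.loopMatrix ρ i.1.1 * (s.frame i.1.1)⁻¹) (element i.2.1).1 (element i.2.1).2

/-- The partial derivative with respect to the folding angle of the crease `j`. -/
def partialDeriv (j : M.Crease) (g : (M.Crease → ℝ) → ℝ) (ρ : M.Crease → ℝ) : ℝ :=
  fderiv ℝ g ρ (Pi.single j 1)

/-- The Jacobian `JA` (rigidity matrix) at the state `s`. -/
def JA : Matrix M.Row M.Crease ℝ := fun i j => partialDeriv j (fun ρ => s.A ρ i) s.ρ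

/-- The Hessian `HA` at the state `s`. -/
def HA (i : M.Row) : Matrix M.Crease M.Crease ℝ :=
  fun j k => partialDeriv k (partialDeriv j (fun ρ => s.A ρ i)) s.ρ

/-- The only first-order flex is `0`. -/
def FirstOrderRigid : Prop := ∀ dρ : M.Crease → ℝ, s.JA *ᵥ dρ = 0 → dρ = 0

/-- Every load is resolved by a stress. -/
def StaticallyRigid : Prop := ∀ l : M.Crease → ℝ, ∃ σ : M.Row → ℝ, s.JAᵀ *ᵥ σ + l = 0

/-- Pre-stress stability. The stiffness matrix `B` is block diagonal, with one block for each single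
creased paper. -/
def PreStressStable : Prop :=
  ∃ B : Matrix M.Row M.Row ℝ, B.PosDef ∧ (∀ i i' : M.Row, i.1 ≠ i'.1 → B i i' = 0) ∧
    ∃ ω : M.Row → ℝ, ω ᵥ* s.JA = 0 ∧ (s.JAᵀ * B * s.JA + ∑ i, ω i • s.HA i).PosDef

/-- A second-order flex `(ρ', ρ'')`. -/
def IsSecondOrderFlex (ρ' ρ'' : M.Crease → ℝ) : Prop :=
  (∀ j, ρ' j ∈ Set.Icc (-Real.pi) Real.pi) ∧ (∀ j, ρ'' j ∈ Set.Icc (-Real.pi) Real.pi) ∧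
    s.JA *ᵥ ρ' = 0 ∧ ∀ i, ρ' ⬝ᵥ (s.HA i *ᵥ ρ') + (s.JA *ᵥ ρ'') i = 0

/-- There are only trivial second-order flexes. -/
def SecondOrderRigid : Prop := ∀ ρ' ρ'', s.IsSecondOrderFlex ρ' ρ'' → ρ' = 0

/-- The energy `E = ∑ f_ℓ(A)`, where `f_ℓ` depends on the constraints of the single creased paper
`ℓ`. -/
def energy (f : (ℓ : M.Single) → (M.Component ℓ → ℝ) → ℝ) (ρ : M.Crease → ℝ) : ℝ :=
  ∑ ℓ, f ℓ fun k => s.A ρ ⟨ℓ, k⟩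

end FoldedState

end CreasedPaper

end

/-! Every folded state satisfies the consistency constraints, so its folding angles lie in the zero
set of the smooth map `A`. Parts (a) and (b) are algebra of the Jacobian `JA` and the Hessians `HA`
alone, and (d) holds because `E` takes one value on all folded states.

The substance is (c). If a zero `ρ` of `A` is not isolated, unit secants from `ρ` to nearby zeros
have a limit direction `v`. Dividing the Taylor expansion by the length of the secant gives `JA v =
0`; dividing by its square shows that the second-order term along `v` lies in the range of `JA`,
which is exactly a second-order flex (`ContDiff.exists_second_order_flex_of_accPt`). No
differentiable path is needed. Hence second-order rigidity isolates `ρ`, and connectedness of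
`[0,1]` freezes the folding angles along any motion.

The stacking must be frozen too. Equal folding angles give congruent placements of the panels
(`Realization.motion_mul_inv_eq`), hence the same contacts, and on a persistent contact a locally
constant order function is constant. -/

/-! ### Second-order calculus on level sets -/

open Filter Topology Asymptotics in
/-- Second-order Taylor expansion of a `C²` map between normed spaces. -/
theorem ContDiff.isLittleO_taylor_two {E F : Type*} [NormedAddCommGroup E] [NormedSpace ℝ E]
    [NormedAddCommGroup F] [NormedSpace ℝ F] {f : E → F} (hf : ContDiff ℝ 2 f) (x : E) :
    (fun d : E => f (x + d) - f x - fderiv ℝ f x d - (1 / 2 : ℝ) • fderiv ℝ (fderiv ℝ f) x d d)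
      =o[𝓝 0] fun d => ‖d‖ ^ 2 := by
  have hf' : Differentiable ℝ (fderiv ℝ f) :=
    (hf.fderiv_right (m := 1) (by norm_num)).differentiable (by norm_num)
  have hsymm : IsSymmSndFDerivAt ℝ f x :=
    hf.contDiffAt.isSymmSndFDerivAt (by simp)
  set g : E → F := fun d =>
    f (x + d) - f x - fderiv ℝ f x d - (1 / 2 : ℝ) • fderiv ℝ (fderiv ℝ f) x d d with hg
  have hder : ∀ d, HasFDerivAt g
      (fderiv ℝ f (x + d) - fderiv ℝ f x - fderiv ℝ (fderiv ℝ f) x d) d := by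
    intro d
    have h1 : HasFDerivAt (fun d => f (x + d)) (fderiv ℝ f (x + d)) d := by
      have := ((hf.differentiable (by norm_num)) (x + d)).hasFDerivAt
      simpa [Function.comp_def] using this.comp d ((hasFDerivAt_id d).const_add x)
    have h2 : HasFDerivAt (fun d => fderiv ℝ (fderiv ℝ f) x d d) _ d :=
      (fderiv ℝ (fderiv ℝ f) x).hasFDerivAt.clm_apply (hasFDerivAt_id d)
    have h3 := ((h1.sub_const (f x)).sub (fderiv ℝ f x).hasFDerivAt).sub
      (h2.const_smul (1 / 2 : ℝ))
    refine h3.congr_fderiv ?_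
    ext w
    -- Symmetry of the second derivative merges the two terms of the product rule, which cancels the
    -- factor `1 / 2`.
    have hs : fderiv ℝ (fderiv ℝ f) x w d = fderiv ℝ (fderiv ℝ f) x d w := hsymm w d
    simp only [sub_apply, smul_apply, add_apply, ContinuousLinearMap.comp_apply,
      ContinuousLinearMap.flip_apply, ContinuousLinearMap.id_apply, hs]
    rw [← two_smul ℝ, smul_smul]
    norm_num
  have hlo : (fun d => fderiv ℝ f (x + d) - fderiv ℝ f x - fderiv ℝ (fderiv ℝ f) x d)
      =o[𝓝 0] fun d => d :=
    hasFDerivAt_iff_isLittleO_nhds_zero.1 (hf' x).hasFDerivAt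
  refine isLittleO_iff.2 fun ε hε => ?_
  obtain ⟨δ, hδ, hball⟩ := Metric.eventually_nhds_iff_ball.1 (isLittleO_iff.1 hlo hε)
  filter_upwards [Metric.ball_mem_nhds (0 : E) hδ] with d hd
  have hd' : ‖d‖ < δ := by simpa using hd
  -- On the ball of radius `‖d‖` the derivative of `g` is at most `ε * ‖d‖`, so the mean value
  -- inequality gives `ε * ‖d‖ ^ 2`.
  have := (convex_closedBall (0 : E) ‖d‖).norm_image_sub_le_of_norm_hasFDerivWithin_le
    (f := g) (C := ε * ‖d‖) (x := 0) (y := d) (fun w _ => (hder w).hasFDerivWithinAt)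
    (fun w hw => by
      have hw' : ‖w‖ ≤ ‖d‖ := by simpa using hw
      exact (hball w (by simpa using hw'.trans_lt hd')).trans (by gcongr))
    (by simp) (by simp)
  have h0 : g 0 = 0 := by simp [hg]
  rw [h0, sub_zero, sub_zero] at this
  simpa [pow_two, mul_assoc] using this

open Filter Topology Asymptotics in
/-- If `x` is an accumulation point of a level set of a `C²` map, then there is a nontrivial
second-order flex at `x`. -/
theorem ContDiff.exists_second_order_flex_of_accPt {E F : Type*} [NormedAddCommGroup E]
    [NormedSpace ℝ E] [FiniteDimensional ℝ E] [NormedAddCommGroup F] [NormedSpace ℝ F]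
    [FiniteDimensional ℝ F] {f : E → F} (hf : ContDiff ℝ 2 f) {x : E}
    (hx : AccPt x (𝓟 {y | f y = f x})) :
    ∃ v, v ≠ 0 ∧ fderiv ℝ f x v = 0 ∧
      ∃ w, fderiv ℝ (fderiv ℝ f) x v v + fderiv ℝ f x w = 0 := by
  have : ProperSpace E := FiniteDimensional.proper ℝ E
  have : (𝓝[≠] x ⊓ 𝓟 {y | f y = f x}).NeBot := hx
  -- An ultrafilter replaces the choice of a subsequence: by compactness of the sphere, the unit
  -- secants converge along it.
  set U := Ultrafilter.of (𝓝[≠] x ⊓ 𝓟 {y | f y = f x})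
  have hU : (U : Filter E) ≤ 𝓝[≠] x ⊓ 𝓟 {y | f y = f x} := Ultrafilter.of_le _
  have hne : ∀ᶠ y in (U : Filter E), y ≠ x :=
    (hU.trans inf_le_left) self_mem_nhdsWithin
  have hZ : ∀ᶠ y in (U : Filter E), f y = f x := hU.trans inf_le_right (mem_principal_self _)
  have hlim : Tendsto (fun y => y - x) U (𝓝 0) := by
    have : Tendsto (fun y : E => y - x) (𝓝 x) (𝓝 (x - x)) := by
      apply Continuous.tendsto; fun_prop
    rw [sub_self] at this
    exact this.mono_left ((hU.trans inf_le_left).trans nhdsWithin_le_nhds)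
  have hsph : ∀ᶠ y in (U : Filter E), ‖y - x‖⁻¹ • (y - x) ∈ Metric.sphere (0 : E) 1 := by
    filter_upwards [hne] with y hy
    have : ‖y - x‖ ≠ 0 := by simpa [sub_eq_zero] using hy
    simp [norm_smul, this]
  obtain ⟨v, hv, hUv⟩ := (isCompact_sphere (0 : E) 1).ultrafilter_le_nhds
    (U.map fun y => ‖y - x‖⁻¹ • (y - x)) (le_principal_iff.2 hsph)
  have hUv : Tendsto (fun y => ‖y - x‖⁻¹ • (y - x)) U (𝓝 v) := hUv
  have hT := ((hf.isLittleO_taylor_two x).comp_tendsto hlim).tendsto_inv_smul_nhds_zero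
  have hQ : Tendsto (fun y => (1 / 2 : ℝ) • fderiv ℝ (fderiv ℝ f) x
      (‖y - x‖⁻¹ • (y - x)) (‖y - x‖⁻¹ • (y - x))) U
      (𝓝 ((1 / 2 : ℝ) • fderiv ℝ (fderiv ℝ f) x v v)) := by
    have hc : Continuous fun u : E => (1 / 2 : ℝ) • fderiv ℝ (fderiv ℝ f) x u u := by fun_prop
    exact (hc.tendsto v).comp hUv
  -- On the level set the Taylor remainder is minus the sum of the linear and quadratic terms;
  -- dividing by `‖y - x‖ ^ 2` isolates the linear one.
  have hL : Tendsto (fun y => fderiv ℝ f x ((‖y - x‖ ^ 2)⁻¹ • (y - x))) U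
      (𝓝 (-((1 / 2 : ℝ) • fderiv ℝ (fderiv ℝ f) x v v))) := by
    have := (hT.add hQ).neg
    rw [zero_add] at this
    refine this.congr' ?_
    filter_upwards [hZ] with y hy
    simp only [Function.comp, add_sub_cancel, hy, sub_self, zero_sub]
    generalize y - x = d
    simp only [map_smul, smul_apply, smul_sub, smul_neg, smul_smul]
    rw [show (1 / 2 : ℝ) * (‖d‖⁻¹ * ‖d‖⁻¹) = (‖d‖ ^ 2)⁻¹ * (1 / 2) by ring]
    abel
  refine ⟨v, ?_, ?_, ?_⟩
  · rintro rfl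
    simp at hv
  · have h1 : Tendsto (fun y => fderiv ℝ f x (‖y - x‖⁻¹ • (y - x))) U (𝓝 (fderiv ℝ f x v)) :=
      ((fderiv ℝ f x).continuous.tendsto v).comp hUv
    -- One factor `‖y - x‖` turns the quotient by the square into the unit secant, and it tends to
    -- `0` while the quotient stays convergent.
    have h2 := hlim.norm.smul hL
    rw [norm_zero, zero_smul] at h2
    refine tendsto_nhds_unique h1 (h2.congr' ?_)
    filter_upwards [hne] with y hy
    have : ‖y - x‖ ≠ 0 := by simpa [sub_eq_zero] using hy
    rw [← map_smul, smul_smul]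
    congr 2
    field_simp
  · have hcl : IsClosed (LinearMap.range (fderiv ℝ f x : E →ₗ[ℝ] F) : Set F) :=
      Submodule.closed_of_finiteDimensional _
    obtain ⟨w, hw⟩ := hcl.mem_of_tendsto hL (Eventually.of_forall fun y => ⟨_, rfl⟩)
    refine ⟨(2 : ℝ) • w, ?_⟩
    have hw : fderiv ℝ f x w = _ := hw
    rw [map_smul, hw, smul_neg, smul_smul]
    norm_num

/-! ### Duality between flexes and stresses -/

/-- The columns of a real matrix are independent if and only if its rows span. -/
theorem Matrix.mulVec_eq_zero_imp_iff_exists_transpose_mulVec {m n : Type*} [Fintype m]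
    [Fintype n] (J : Matrix m n ℝ) :
    (∀ d, J *ᵥ d = 0 → d = 0) ↔ ∀ l : n → ℝ, ∃ σ : m → ℝ, Jᵀ *ᵥ σ + l = 0 := by
  classical
  constructor
  · intro h l
    have hinj : Function.Injective J.mulVec := fun a b hab =>
      sub_eq_zero.1 (h _ (by rw [Matrix.mulVec_sub, hab, sub_self]))
    have hpd : (Jᵀ * J).PosDef := by
      simpa using Matrix.PosDef.conjTranspose_mul_self J hinj
    -- The least-squares solution of the equilibrium equation.
    refine ⟨J *ᵥ ((Jᵀ * J)⁻¹ *ᵥ (-l)), ?_⟩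
    rw [Matrix.mulVec_mulVec, Matrix.mulVec_mulVec,
      Matrix.mul_nonsing_inv _ ((Matrix.isUnit_iff_isUnit_det _).1 hpd.isUnit), Matrix.one_mulVec,
      neg_add_cancel]
  · intro h d hd
    -- The flex itself serves as the load: a stress resolving it does no work on `d`, so `d ⬝ᵥ d =
    -- 0`.
    obtain ⟨σ, hσ⟩ := h d
    have : d ⬝ᵥ d = 0 := by
      have h1 : d ⬝ᵥ (Jᵀ *ᵥ σ + d) = 0 := by rw [hσ, dotProduct_zero]
      rwa [dotProduct_add, Matrix.dotProduct_mulVec, Matrix.vecMul_transpose, hd,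
        zero_dotProduct, zero_add] at h1
    exact dotProduct_self_eq_zero.1 this

/-! ### Smoothness of the loop matrices -/

noncomputable section

theorem det_homogeneous (R : Matrix (Fin 3) (Fin 3) ℝ) (v : Fin 3 → ℝ) :
    (homogeneous R v).det = R.det := by
  simp [homogeneous, Matrix.det_succ_row_zero, Fin.sum_univ_succ, Fin.succAbove]

theorem det_planarMotion (β : ℝ) (v : ℂ) : (planarMotion β v).det = 1 := by
  simp [planarMotion, Matrix.det_succ_row_zero, Fin.sum_univ_succ, Fin.succAbove]
  nlinarith [Real.sin_sq_add_cos_sq β]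

theorem contDiff_rotX_apply (n : WithTop ℕ∞) (i j : Fin 4) :
    ContDiff ℝ n fun θ => rotX θ i j := by
  fin_cases i <;> fin_cases j <;> simp [rotX] <;> fun_prop

/-- Products of matrices with smooth entries have smooth entries. -/
theorem contDiff_matrix_mul_apply {E m : Type*} [NormedAddCommGroup E] [NormedSpace ℝ E]
    [Fintype m] {n : WithTop ℕ∞} {A B : E → Matrix m m ℝ}
    (hA : ∀ i j, ContDiff ℝ n fun x => A x i j) (hB : ∀ i j, ContDiff ℝ n fun x => B x i j)
    (i j : m) : ContDiff ℝ n fun x => (A x * B x) i j := by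
  simp only [Matrix.mul_apply]
  exact ContDiff.sum fun k _ => (hA i k).mul (hB k j)

theorem contDiff_matrix_list_prod_apply {E m ι : Type*} [NormedAddCommGroup E] [NormedSpace ℝ E]
    [Fintype m] [DecidableEq m] {n : WithTop ℕ∞} {A : E → ι → Matrix m m ℝ}
    (hA : ∀ a i j, ContDiff ℝ n fun x => A x a i j) (l : List ι) (i j : m) :
    ContDiff ℝ n fun x => ((l.map (A x)).prod) i j := by
  induction l generalizing i j with
  | nil => simpa using contDiff_const
  | cons a l ih =>
    simp only [List.map_cons, List.prod_cons]
    exact contDiff_matrix_mul_apply (hA a) ih i j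

namespace PolygonalMesh

variable {S : Type*} [Fintype S] (M : PolygonalMesh S)

theorem contDiff_angleAt (n : WithTop ℕ∞) (a : S) : ContDiff ℝ n fun ρ => M.angleAt ρ a := by
  unfold angleAt
  split_ifs
  · exact contDiff_apply ℝ ℝ _
  · exact contDiff_const

theorem contDiff_loopMatrix_apply (n : WithTop ℕ∞) (ℓ : M.Loop) (i j : Fin 4) :
    ContDiff ℝ n fun ρ => M.loopMatrix ρ ℓ i j :=
  contDiff_matrix_list_prod_apply
    (A := fun ρ k => M.stepMatrix ρ (M.turn^[k] (M.baseSide ℓ)))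
    (fun k => contDiff_matrix_mul_apply
      (A := fun _ => planarMotion (M.stepAngle (M.turn^[k] (M.baseSide ℓ)))
        (M.stepShift (M.turn^[k] (M.baseSide ℓ))))
      (B := fun ρ => rotX (M.angleAt ρ (M.stepSide (M.turn^[k] (M.baseSide ℓ)))))
      (fun _ _ => contDiff_const) fun i j =>
      (contDiff_rotX_apply n i j).comp (M.contDiff_angleAt n _)) _ i j

end PolygonalMesh

/-! ### Folding angles determine the placement and the contacts -/

namespace CreasedPaper

variable {S : Type*} [Fintype S] {M : CreasedPaper S}

namespace Realization

/-- The homogeneous matrix of the rigid motion of a panel. -/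
def motion (R : M.Realization) (P : M.Panel) : Matrix (Fin 4) (Fin 4) ℝ :=
  homogeneous (R.rot P) (R.trans P)

theorem isUnit_det_motion (R : M.Realization) (P : M.Panel) : IsUnit (R.motion P).det := by
  rw [motion, det_homogeneous, (Matrix.mem_specialOrthogonalGroup_iff.1 (R.rot_mem P)).2]
  exact isUnit_one

/-- Across a crease, the motion of the neighbouring panel is that of the first panel times a matrix
`Y` depending only on the mesh and the folding angle. Equal angles give the same `Y`, which cancels
in the quotient of the two motions. -/
theorem motion_glue {R R' : M.Realization} (h : R.ρ = R'.ρ) (a : S) :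
    R'.motion (M.panel (M.glue a)) * (R.motion (M.panel (M.glue a)))⁻¹ =
      R'.motion (M.panel a) * (R.motion (M.panel a))⁻¹ := by
  by_cases ha : M.glue a = a
  · rw [ha]
  have hF : IsUnit (M.sideFrame (M.glue a)).det := by
    rw [PolygonalMesh.sideFrame, det_planarMotion]; exact isUnit_one
  set Y := M.sideFrameRev a * rotX (M.angleAt R.ρ a) * (M.sideFrame (M.glue a))⁻¹ with hY
  have hmul : ∀ R' : M.Realization, R.ρ = R'.ρ →
      R'.motion (M.panel (M.glue a)) = R'.motion (M.panel a) * Y := by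
    intro R' h
    have := congrArg (· * (M.sideFrame (M.glue a))⁻¹) (R'.hinge a ha)
    simp only [Matrix.mul_assoc, Matrix.mul_nonsing_inv _ hF, Matrix.mul_one] at this
    simpa only [motion, hY, h, Matrix.mul_assoc] using this
  have h1 := hmul R rfl
  have h2 := hmul R' h
  have h3 : Y * (R.motion (M.panel (M.glue a)))⁻¹ = (R.motion (M.panel a))⁻¹ := by
    have := Matrix.mul_nonsing_inv _ (R.isUnit_det_motion (M.panel (M.glue a)))
    nth_rewrite 1 [h1] at this
    rw [Matrix.mul_assoc] at this
    exact (Matrix.inv_eq_right_inv this).symm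
  rw [h2, Matrix.mul_assoc, h3]

/-- The realization is determined by its folding angles up to a Euclidean motion. -/
theorem motion_mul_inv_eq {R R' : M.Realization} (h : R.ρ = R'.ρ) (P Q : M.Panel) :
    R'.motion P * (R.motion P)⁻¹ = R'.motion Q * (R.motion Q)⁻¹ := by
  obtain ⟨a, rfl⟩ := Quot.exists_rep P
  obtain ⟨b, rfl⟩ := Quot.exists_rep Q
  change R'.motion (M.panel a) * (R.motion (M.panel a))⁻¹ =
    R'.motion (M.panel b) * (R.motion (M.panel b))⁻¹
  induction M.connected a b with
  | rel a b hab =>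
    rcases hab with rfl | rfl
    · rw [show M.panel (M.next a) = M.panel a from
        (Quot.sound (r := fun a b : S => M.next a = b) rfl).symm]
    · exact (motion_glue h a).symm
  | refl a => rfl
  | symm a b _ ih => exact ih.symm
  | trans a b c _ _ ih₁ ih₂ => exact ih₁.trans ih₂

theorem motion_mulVec (R : M.Realization) (x : M.Panel × ℂ) :
    R.motion x.1 *ᵥ ![x.2.re, x.2.im, 0, 1] = ![R.f x 0, R.f x 1, R.f x 2, 1] := by
  ext i
  fin_cases i <;> simp [motion, homogeneous, f, Matrix.mulVec, dotProduct, Fin.sum_univ_succ] <;>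
    ring

theorem f_eq_of_f_eq {R R' : M.Realization} (h : R.ρ = R'.ρ) {p q : M.Panel × ℂ}
    (hpq : R.f p = R.f q) : R'.f p = R'.f q := by
  -- One matrix, the same for all panels, carries the first image to the second, so coincidences of
  -- points are preserved.
  have key : ∀ x : M.Panel × ℂ, ![R'.f x 0, R'.f x 1, R'.f x 2, 1] =
      (R'.motion p.1 * (R.motion p.1)⁻¹) *ᵥ ![R.f x 0, R.f x 1, R.f x 2, 1] := by
    intro x
    rw [motion_mul_inv_eq h p.1 x.1, ← motion_mulVec, ← motion_mulVec, Matrix.mulVec_mulVec,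
      Matrix.mul_assoc, Matrix.nonsing_inv_mul _ (R.isUnit_det_motion _), Matrix.mul_one]
  have hv : ![R'.f p 0, R'.f p 1, R'.f p 2, 1] = ![R'.f q 0, R'.f q 1, R'.f q 2, 1] := by
    rw [key p, key q, hpq]
  ext i
  fin_cases i
  · exact congrFun hv 0
  · exact congrFun hv 1
  · exact congrFun hv 2

theorem contact_congr {R R' : M.Realization} (h : R.ρ = R'.ρ) (p q : M.Panel × ℂ) :
    R.Contact p q ↔ R'.Contact p q := by
  unfold Contact
  rw [show R.f p = R.f q ↔ R'.f p = R'.f q from ⟨f_eq_of_f_eq h, f_eq_of_f_eq h.symm⟩]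

end Realization

/-! ### The constraint map, its derivatives, and the algebraic implications -/

namespace FoldedState

variable (s : M.FoldedState)

theorem contDiff_A (n : WithTop ℕ∞) : ContDiff ℝ n s.A :=
  contDiff_pi.2 fun i => contDiff_matrix_mul_apply
    (A := fun ρ => s.frame i.1.1 * M.loopMatrix ρ i.1.1) (B := fun _ => (s.frame i.1.1)⁻¹)
    (contDiff_matrix_mul_apply (A := fun _ => s.frame i.1.1) (B := fun ρ => M.loopMatrix ρ i.1.1)
      (fun _ _ => contDiff_const) (M.contDiff_loopMatrix_apply n i.1.1))
    (fun _ _ => contDiff_const) _ _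

/-- The identity is unchanged by conjugation, and `element` selects only off-diagonal entries. -/
theorem A_eq_zero {ρ : M.Crease → ℝ} (h : M.Consistent ρ) : s.A ρ = 0 := by
  have hdet : ∀ ℓ, IsUnit (s.frame ℓ).det := fun ℓ => by
    rw [frame, Matrix.det_mul, PolygonalMesh.sideFrame, det_planarMotion, mul_one]
    exact s.isUnit_det_motion _
  ext i
  rw [A, h i.1, Matrix.mul_one, Matrix.mul_nonsing_inv _ (hdet _)]
  have hne : ∀ k, (element k).1 ≠ (element k).2 := by decide
  exact Matrix.one_apply_ne (hne _)

theorem sum_mul_partialDeriv (g : (M.Crease → ℝ) → ℝ) (ρ d : M.Crease → ℝ) :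
    ∑ j, d j * partialDeriv j g ρ = fderiv ℝ g ρ d := by
  conv_rhs => rw [pi_eq_sum_univ' d, map_sum]
  simp [partialDeriv]

theorem fderiv_A_apply_apply (ρ d : M.Crease → ℝ) (i : M.Row) :
    fderiv ℝ s.A ρ d i = fderiv ℝ (fun ρ => s.A ρ i) ρ d := by
  rw [fderiv_apply ((s.contDiff_A 2).differentiable (by norm_num) ρ)]
  rfl

theorem fderiv_A_apply (d : M.Crease → ℝ) : fderiv ℝ s.A s.ρ d = s.JA *ᵥ d := by
  ext i
  rw [fderiv_A_apply_apply, ← sum_mul_partialDeriv]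
  exact Finset.sum_congr rfl fun j _ => mul_comm _ _

/-- This identifies the coordinate-free second derivative in the flex criterion with the form of
`HA`, by commuting differentiation with evaluation at a basis vector and with taking the row `i`. -/
theorem fderiv_fderiv_A_apply (d : M.Crease → ℝ) (i : M.Row) :
    fderiv ℝ (fderiv ℝ s.A) s.ρ d d i = d ⬝ᵥ (s.HA i *ᵥ d) := by
  have hd : DifferentiableAt ℝ (fderiv ℝ s.A) s.ρ :=
    ((s.contDiff_A 2).fderiv_right (m := 1) (by norm_num)).differentiable (by norm_num) _
  have hrow : ∀ j, (s.HA i *ᵥ d) j = fderiv ℝ (fderiv ℝ s.A) s.ρ d (Pi.single j 1) i := by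
    intro j
    have h1 : (s.HA i *ᵥ d) j = fderiv ℝ (partialDeriv j fun ρ => s.A ρ i) s.ρ d := by
      rw [← sum_mul_partialDeriv]
      exact Finset.sum_congr rfl fun k _ => mul_comm _ _
    have h2 : (partialDeriv j fun ρ => s.A ρ i) =
        fun ρ => (fderiv ℝ s.A ρ (Pi.single j 1)) i :=
      funext fun ρ => (s.fderiv_A_apply_apply ρ _ i).symm
    have h3 : DifferentiableAt ℝ (fun ρ => fderiv ℝ s.A ρ (Pi.single j 1)) s.ρ :=
      hd.clm_apply (differentiableAt_const _)
    rw [h1, h2, fderiv_apply h3, fderiv_clm_apply hd (differentiableAt_const _)]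
    simp
  rw [dotProduct]
  simp only [hrow]
  conv_lhs => arg 2; rw [pi_eq_sum_univ' d]
  simp [Finset.sum_apply]

/-- No prestress is needed: with unit stiffness and `ω = 0` the form is the Gram matrix of the
independent columns of `JA`. -/
theorem preStressStable_of_firstOrderRigid (h : s.FirstOrderRigid) : s.PreStressStable := by
  classical
  refine ⟨1, Matrix.PosDef.one, fun i i' hi => Matrix.one_apply_ne fun e => hi (e ▸ rfl), 0,
    Matrix.zero_vecMul _, ?_⟩
  have hinj : Function.Injective s.JA.mulVec := fun a b hab =>
    sub_eq_zero.1 (h _ (by rw [Matrix.mulVec_sub, hab, sub_self]))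
  simpa using Matrix.PosDef.conjTranspose_mul_self s.JA hinj

/-- The form is tested on the flex `ρ'`. The stiffness term dies because `JA ρ' = 0`. Pairing the
second-order equation with `ω` removes `ρ''`, since `ω` annihilates the range of `JA`, so the
Hessian term dies as well; positive definiteness forces `ρ' = 0`. -/
theorem secondOrderRigid_of_preStressStable (h : s.PreStressStable) : s.SecondOrderRigid := by
  obtain ⟨B, -, -, ω, hω, hpd⟩ := h
  rintro ρ' ρ'' ⟨-, -, h1, h2⟩
  by_contra hne
  have hpos := hpd.dotProduct_mulVec_pos hne
  refine hpos.ne' ?_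
  have hB : (s.JAᵀ * B * s.JA) *ᵥ ρ' = 0 := by
    rw [← Matrix.mulVec_mulVec, h1, Matrix.mulVec_zero]
  have hsum : ρ' ⬝ᵥ ((∑ i, ω i • s.HA i) *ᵥ ρ') = ∑ i, ω i * (ρ' ⬝ᵥ (s.HA i *ᵥ ρ')) := by
    simp [Matrix.sum_mulVec, dotProduct_sum, Matrix.smul_mulVec]
  have hω' : ω ⬝ᵥ (s.JA *ᵥ ρ'') = 0 := by
    rw [Matrix.dotProduct_mulVec, hω, zero_dotProduct]
  have htot : ∑ i, ω i * (ρ' ⬝ᵥ (s.HA i *ᵥ ρ') + (s.JA *ᵥ ρ'') i) = 0 :=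
    Finset.sum_eq_zero fun i _ => by rw [h2 i, mul_zero]
  simp only [mul_add, Finset.sum_add_distrib] at htot
  rw [dotProduct] at hω'
  rw [star_trivial, Matrix.add_mulVec, hB, zero_add, hsum]
  linarith

end FoldedState
end CreasedPaper
end

/-! ### Rigidity from second-order rigidity, and global rigidity from energy -/

noncomputable section
namespace CreasedPaper

variable {S : Type*} [Fintype S] {M : CreasedPaper S}

namespace FoldedState

variable (s : M.FoldedState)

/-- A second-order flex may be rescaled, so the bounds on its entries are immaterial. -/
theorem SecondOrderRigid.eq_zero {s : M.FoldedState} (h : s.SecondOrderRigid)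
    {v w : M.Crease → ℝ} (hv : s.JA *ᵥ v = 0)
    (hw : ∀ i, v ⬝ᵥ (s.HA i *ᵥ v) + (s.JA *ᵥ w) i = 0) : v = 0 := by
  obtain ⟨ε, hε, hεv, hεw⟩ : ∃ ε : ℝ, 0 < ε ∧ (∀ j, |ε * v j| ≤ Real.pi) ∧
      ∀ j, |ε ^ 2 * w j| ≤ Real.pi := by
    -- The second-order equation is homogeneous under `(v, w) ↦ (ε v, ε² w)`; this `ε` brings all
    -- entries below `1 ≤ π`.
    refine ⟨(1 + ‖v‖ + ‖w‖)⁻¹, by positivity, fun j => ?_, fun j => ?_⟩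
    all_goals
      refine le_trans ?_ (by linarith [Real.pi_gt_three] : (1 : ℝ) ≤ Real.pi)
      have h1 : (1 : ℝ) ≤ 1 + ‖v‖ + ‖w‖ := by linarith [norm_nonneg v, norm_nonneg w]
      have hinv : (1 + ‖v‖ + ‖w‖)⁻¹ ≤ 1 := inv_le_one_of_one_le₀ h1
    · have hj : |v j| ≤ ‖v‖ := norm_le_pi_norm v j
      rw [abs_mul, abs_of_nonneg (by positivity), inv_mul_le_iff₀ (by positivity)]
      linarith [norm_nonneg w]
    · have hj : |w j| ≤ ‖w‖ := norm_le_pi_norm w j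
      rw [abs_mul, abs_of_nonneg (by positivity), inv_pow, inv_mul_le_iff₀ (by positivity)]
      nlinarith [norm_nonneg v]
  have hflex : s.IsSecondOrderFlex (ε • v) (ε ^ 2 • w) := by
    refine ⟨fun j => abs_le.1 (hεv j), fun j => abs_le.1 (hεw j), ?_, fun i => ?_⟩
    · rw [Matrix.mulVec_smul, hv, smul_zero]
    · rw [Matrix.mulVec_smul, Matrix.mulVec_smul, smul_dotProduct, dotProduct_smul, Pi.smul_apply]
      simp only [smul_eq_mul]
      linear_combination ε ^ 2 * hw i
  exact (smul_eq_zero.1 (h _ _ hflex)).resolve_left hε.ne'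

open Filter Topology in
/-- At a second-order rigid state, the folding angles are isolated among the zeros of `A`. -/
theorem SecondOrderRigid.eventually_eq {s : M.FoldedState} (h : s.SecondOrderRigid) :
    ∀ᶠ ρ in 𝓝 s.ρ, s.A ρ = s.A s.ρ → ρ = s.ρ := by
  have hacc : ¬ AccPt s.ρ (𝓟 {ρ | s.A ρ = s.A s.ρ}) := by
    intro hacc
    obtain ⟨v, hv0, hv, w, hw⟩ := (s.contDiff_A 2).exists_second_order_flex_of_accPt hacc
    rw [fderiv_A_apply] at hv
    refine hv0 (h.eq_zero (w := w) hv fun i => ?_)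
    rw [← fderiv_fderiv_A_apply, ← fderiv_A_apply]
    exact congrFun hw i
  rw [accPt_iff_frequently] at hacc
  filter_upwards [not_frequently.1 hacc] with ρ hρ hA
  by_contra hne
  exact hρ ⟨hne, hA⟩

/-- Along a rigid folding motion starting at a second-order rigid state, the folding angles are
constant. -/
theorem SecondOrderRigid.motion_ρ_eq {s : M.FoldedState} (h : s.SecondOrderRigid)
    {γ : unitInterval → M.FoldedState} (hγ : IsMotion γ) (h0 : γ 0 = s) (t : unitInterval) :
    (γ t).ρ = s.ρ := by
  -- Closed by continuity of the angles; open because every state of the motion is a zero of `A` and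
  -- `s.ρ` is an isolated one.
  have hclopen : IsClopen {t | (γ t).ρ = s.ρ} := by
    refine ⟨isClosed_eq hγ.2.1 continuous_const, isOpen_iff_mem_nhds.2 fun t ht => ?_⟩
    have ht : (γ t).ρ = s.ρ := ht
    have hev := h.eventually_eq
    rw [← ht] at hev
    filter_upwards [hγ.2.1.continuousAt.eventually hev] with t' ht'
    refine (ht' ?_).trans ht
    rw [s.A_eq_zero (γ t').consistent, s.A_eq_zero (γ t).consistent]
  have huniv := hclopen.eq_univ ⟨0, congrArg (fun u : M.FoldedState => u.ρ) h0⟩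
  exact Set.eq_univ_iff_forall.1 huniv t

/-- Along a rigid folding motion with constant folding angles, the stacking is constant. -/
theorem IsMotion.order_eq {γ : unitInterval → M.FoldedState} (hγ : IsMotion γ)
    (hρ : ∀ t, (γ t).ρ = (γ 0).ρ) : (γ 1).order = (γ 0).order := by
  funext p q
  -- Contacts depend only on the folding angles, so a pair in contact once stays in contact and
  -- continuity of the order applies at all times.
  have hc : ∀ t t', (γ t).Contact p q → (γ t').Contact p q := fun t t' =>
    (Realization.contact_congr ((hρ t).trans (hρ t').symm) p q).1
  by_cases h : (γ 0).Contact p q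
  · have hloc : IsLocallyConstant fun t => (γ t).order p q := by
      refine (IsLocallyConstant.iff_eventually_eq _).2 fun t => ?_
      obtain ⟨δ, hδ, hord⟩ := hγ.2.2 t p q (hc 0 t h)
      filter_upwards [Metric.ball_mem_nhds t hδ] with t' ht'
      exact hord t' p.2 q.2 ht' (by simpa using hδ) (by simpa using hδ) (hc 0 t' h)
    exact hloc.apply_eq_of_preconnectedSpace 1 0
  -- A pair never in contact has the default order `0` at both ends.
  · rw [not_not.1 (mt ((γ 0).order_ne_zero_iff p q).1 h),
      not_not.1 (mt ((γ 1).order_ne_zero_iff p q).1 (mt (hc 1 0) h))]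

theorem rigid_of_secondOrderRigid (h : s.SecondOrderRigid) : s.Rigid := by
  rintro s' ⟨hne, γ, hγ, rfl, rfl⟩
  have hρ := h.motion_ρ_eq hγ rfl
  exact hne ⟨(hρ 1).symm, (hγ.order_eq hρ).symm⟩

/-- `A` vanishes at the angles of every folded state, so all of them have the energy of the strict
minimizer and must coincide with it. -/
theorem globallyRigid_of_energy_lt (f : (ℓ : M.Single) → (M.Component ℓ → ℝ) → ℝ)
    (hmin : ∀ ρ : M.Crease → ℝ, (∀ j, ρ j ∈ Set.Icc (-Real.pi) Real.pi) → ρ ≠ s.ρ →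
      s.energy f s.ρ < s.energy f ρ) : M.GloballyRigid := by
  refine ⟨s.ρ, Set.eq_singleton_iff_unique_mem.2 ⟨⟨s, rfl⟩, ?_⟩⟩
  rintro _ ⟨s', rfl⟩
  by_contra hne
  have hE : s.energy f s'.ρ = s.energy f s.ρ := by
    simp only [energy, s.A_eq_zero s'.consistent, s.A_eq_zero s.consistent]
  exact (hmin _ s'.ρ_mem hne).ne' hE

end FoldedState

end CreasedPaper
end

theorem mainTheorem2 {S : Type*} [Fintype S] (M : CreasedPaper S) (s : M.FoldedState) :
    ((s.FirstOrderRigid ↔ s.StaticallyRigid) ∧ (s.FirstOrderRigid → s.PreStressStable)) ∧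
    (s.PreStressStable → s.SecondOrderRigid) ∧
    (s.SecondOrderRigid → s.Rigid) ∧
    (∀ f : (ℓ : M.Single) → (M.Component ℓ → ℝ) → ℝ, (∀ ℓ, ContDiff ℝ 2 (f ℓ)) →
      (∀ ρ : M.Crease → ℝ, (∀ j, ρ j ∈ Set.Icc (-Real.pi) Real.pi) → ρ ≠ s.ρ →
        s.energy f s.ρ < s.energy f ρ) →
      M.GloballyRigid) :=
  ⟨⟨s.JA.mulVec_eq_zero_imp_iff_exists_transpose_mulVec, s.preStressStable_of_firstOrderRigid⟩,
    s.secondOrderRigid_of_preStressStable, s.rigid_of_secondOrderRigid,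
    fun f _ hmin => s.globallyRigid_of_energy_lt f hmin⟩
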